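/- Let $(R,\mathfrak m)$ be a one-dimensional Noetherian local domain with infinite residue field $k$ and quotient field $K$, whose integral closure $\overline R$ in $K$ is a finite $R$-module and a discrete valuation ring (with valuation $v$ of $K$, normalized to have value $1$ on a uniformizer), and suppose that the natural map from $k$ to the residue field of $\overline R$ is an isomorphism. Let $I$ be a non-principal $\mathfrak m$-primary ideal of $R$. Write $\ell$ for the length of $R$-modules, $A:B=\{x\in K\mid xB\subseteq A\}$ for $R$-submodules $A,B$ of $K$, $A^{*}=R:A$, and $v(A)=\{v(x)\mid x\in A,\ x\ne 0\}$. *Invariants of $I$.* Let $h_I(z)\in\mathbb Z[z]$ be the polynomial with $\sum_{n\ge 0}\ell(I^n/I^{n+1})z^n=h_I(z)/(1-z)$; put $e=h_I(1)$ (the multiplicity of $I$) and $\rho=h_I'(1)$ (the genus of $I$). A minimal reduction of $I$ is an element $x\in I$ with $I^{n+1}=xI^n$ for all sufficiently large $n$; for such an $x$ let $\nu$, the reduction exponent, be the least integer with $I^{n+1}=xI^n$ for all $n\ge\nu$. Let $\Lambda=\bigcup_{n\ge 0}(I^n:I^n)$ be the blowing-up of $R$ along $I$. *Type sequence of $R$.*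 Let $\gamma=R:\overline R$, $n=\ell(R/\gamma)$, and let $0=s_0<s_1<\dots<s_n$ be the first $n+1$ elements of $v(R)$. Put $R_i=\{x\in R\mid v(x)\ge s_i\}$ for $0\le i\le n$ and $r_i=\ell\big((R:R_i)/(R:R_{i-1})\big)$ for $1\le i\le n$. Finally let $$\Gamma=\{i\in\{1,\dots,n\}\mid s_{i-1}\in v(R:\Lambda)\},\qquad d(R:\Lambda)=\ell(\overline R/\Lambda^{**})-\sum_{i\in\Gamma}r_i ,$$ and let $\sum_{i\notin\Gamma}$ denote the sum over $i\in\{1,\dots,n\}\setminus\Gamma$. Then $I$ has a minimal reduction, and for every minimal reduction of $I$ the following hold. 1. $\displaystyle 2\rho=e\nu+\sum_{i\notin\Gamma}(r_i-1)-d(R:\Lambda)-\ell(\Lambda^{**}/\Lambda)-\ell\big((R:\Lambda)/I^{\nu}\big).$ 2. $\displaystyle 2\rho=e\nu+\sum_{i\notin\Gamma}(r_i-1)$ if and only if $R:\Lambda=I^{\nu}$ and $d(R:\Lambda)=0$. -/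

import Mathlib

open scoped Polynomial PowerSeries

noncomputable section

namespace BlowUp

/-! ### Rings and fractional ideals -/

section Rings

variable (R : Type*) [CommRing R] (K : Type*) [Field K] [Algebra R K]

/-- `R` itself, as an `R`-submodule of its quotient field `K`. -/
abbrev base : Submodule R K := 1

/-- The integral closure of `R` in `K`, as an `R`-submodule of `K`. -/
abbrev intCl : Submodule R K := Subalgebra.toSubmodule (integralClosure R K)

/-- The dual `J* = R : J = {x ∈ K | x J ⊆ R}`; Mathlib's quotient `A / B` of submodules of `K`
is `{x : K | x B ⊆ A}`. -/
def dual {R : Type*} [CommRing R] {K : Type*} [Field K] [Algebra R K] (J : Submodule R K) :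
    Submodule R K := base R K / J

/-- The conductor ideal `R : intCl R K`. -/
def conductor : Submodule R K := dual (intCl R K)

variable {R K}

/-- The length of the `R`-module `A / B` for `B ⊆ A ⊆ K` (used only when it is finite). -/
def len (A B : Submodule R K) : ℕ := (Module.length R (A ⧸ B.submoduleOf A)).toNat

variable (R K) in
/-- Residual rationality: the natural map from `R` to the residue field of its integral closure
is onto, so that it induces an isomorphism of residue fields. -/
def ResiduallyRational [IsLocalRing (integralClosure R K)] : Prop :=
  Function.Surjective
    ((IsLocalRing.residue (integralClosure R K)).comp (algebraMap R (integralClosure R K)))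

end Rings

/-! ### The valuation, the value semigroup and the type sequence -/

section Valuation

variable (R : Type*) [CommRing R] [IsDomain R] (K : Type*) [Field K] [Algebra R K]
  [IsFractionRing R K]

theorem isFractionRing_intCl : IsFractionRing (integralClosure R K) K :=
  integralClosure.isFractionRing_of_finite_extension (A := R) K K

variable [IsDiscreteValuationRing (integralClosure R K)]

/-- The valuation of `K` associated with the discrete valuation ring `integralClosure R K`, in
multiplicative notation: an element of (additive) value `n` has value `WithZero.exp (-n)`. -/
def val : Valuation K (WithZero (Multiplicative ℤ)) :=
  haveI := isFractionRing_intCl R K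
  (IsDiscreteValuationRing.maximalIdeal (integralClosure R K)).valuation K

variable {R K}

/-- The value set `v(J) = {v(x) | x ∈ J, x ≠ 0} ⊆ ℤ`. -/
def valueSet (J : Submodule R K) : Set ℤ :=
  {n | ∃ x ∈ J, val R K x = WithZero.exp (-n)}

variable (R K)

/-- `n = ℓ(R / conductor) = c - δ`. -/
def typeLength : ℕ := len (base R K) (conductor R K)

/-- `semi R K i` is `s_i`, the `i`-th element (counted from `i = 0`) of the numerical semigroup `v(R) ⊆ ℕ`. -/
def semi (i : ℕ) : ℕ := Nat.nth (fun m : ℕ => (m : ℤ) ∈ valueSet (base R K)) i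

theorem val_algebraMap_le_one (a : R) : val R K (algebraMap R K a) ≤ 1 := by
  have := isFractionRing_intCl R K
  exact (IsDiscreteValuationRing.maximalIdeal (integralClosure R K)).valuation_le_one
    (K := K) (algebraMap R (integralClosure R K) a)

/-- `R_i = {x ∈ R | v(x) ≥ s_i}`. -/
def filt (i : ℕ) : Submodule R K where
  carrier := {x | x ∈ base R K ∧ val R K x ≤ WithZero.exp (-(semi R K i : ℤ))}
  zero_mem' := ⟨zero_mem _, by simp⟩
  add_mem' := fun ha hb => ⟨add_mem ha.1 hb.1, (val R K).map_add_le ha.2 hb.2⟩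
  smul_mem' := fun a x hx => ⟨Submodule.smul_mem _ a hx.1, by
    rw [Algebra.smul_def, map_mul]
    exact (mul_le_of_le_one_left' (val_algebraMap_le_one R K a)).trans hx.2⟩

/-- The type sequence: `r_i = ℓ((R : R_i) / (R : R_{i-1}))`, for `1 ≤ i ≤ n`. -/
def typeSeq (i : ℕ) : ℕ := len (dual (filt R K i)) (dual (filt R K (i - 1)))

variable {R K}

open Classical in
/-- `Γ = {i ∈ {1, …, n} | s_{i-1} ∈ v(J)}`; used for `J = R : Λ`. -/
def Gam (J : Submodule R K) : Finset ℕ :=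
  (Finset.Icc 1 (typeLength R K)).filter fun i => (semi R K (i - 1) : ℤ) ∈ valueSet J

/-- `d(J) = ℓ(intCl R K / (R : J)) - ∑_{i ∈ Γ} r_i`; for `J = R : Λ` one has `R : J = Λ**`. -/
def dInv (J : Submodule R K) : ℤ :=
  (len (intCl R K) (dual J) : ℤ) - ∑ i ∈ Gam J, (typeSeq R K i : ℤ)

end Valuation

/-! ### Invariants of an ideal -/

section IdealInvariants

variable {R : Type*} [CommRing R]

/-- `x` is a minimal reduction of `I`: `x ∈ I` and `I^(n+1) = x I^n` for `n ≫ 0`. -/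
def IsMinimalReduction (I : Ideal R) (x : R) : Prop :=
  x ∈ I ∧ ∃ N : ℕ, ∀ n ≥ N, I ^ (n + 1) = Ideal.span {x} * I ^ n

/-- The reduction exponent: the least `m` with `I^(n+1) = x I^n` for all `n ≥ m`,
where `x` is a minimal reduction of `I`. -/
def reductionExponent (I : Ideal R) (x : R) : ℕ :=
  sInf {m : ℕ | ∀ n ≥ m, I ^ (n + 1) = Ideal.span {x} * I ^ n}

/-- The Hilbert function `H_I(n) = ℓ(I^n / I^(n+1))`. -/
def hilbertFunction (I : Ideal R) (n : ℕ) : ℕ :=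
  (Module.length R (↥(I ^ n) ⧸ (I ^ (n + 1)).submoduleOf (I ^ n))).toNat

/-- The Hilbert–Poincaré series `P_I(z) = ∑ H_I(n) z^n`. -/
def hilbertSeries (I : Ideal R) : ℤ⟦X⟧ := PowerSeries.mk fun n => (hilbertFunction I n : ℤ)

open Classical in
/-- The `h`-polynomial: the polynomial `h_I` with `P_I(z) = h_I(z) / (1 - z)`. -/
def hPolynomial (I : Ideal R) : ℤ[X] :=
  if h : ∃ p : ℤ[X], (p : ℤ⟦X⟧) = (1 - PowerSeries.X) * hilbertSeries I then h.choose else 0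

/-- The multiplicity `e(I) = h_I(1)`. -/
def idealMult (I : Ideal R) : ℤ := (hPolynomial I).eval 1

/-- The genus `ρ(I) = h_I'(1)`. -/
def genus (I : Ideal R) : ℤ := (Polynomial.derivative (hPolynomial I)).eval 1

variable (K : Type*) [Field K] [Algebra R K]

/-- The power `I^n` as an `R`-submodule of `K`. -/
abbrev powK (I : Ideal R) (n : ℕ) : Submodule R K := IsLocalization.coeSubmodule K (I ^ n)

/-- The blowing-up `Λ(I) = ⋃ₙ (I^n : I^n)`; see `mem_Lam` for the fact that this supremum
is the union. -/
def Lam (I : Ideal R) : Submodule R K := ⨆ n : ℕ, powK K I n / powK K I n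

theorem powK_div_powK_mono (I : Ideal R) : Monotone fun n : ℕ => powK K I n / powK K I n := by
  refine monotone_nat_of_le_succ fun n x hx => ?_
  rw [Submodule.mem_div_iff_forall_mul_mem] at hx ⊢
  intro y hy
  have e : powK K I (n + 1) = powK K I n * powK K I 1 := by
    rw [← IsLocalization.coeSubmodule_mul, ← pow_add]
  rw [e] at hy ⊢
  induction hy using Submodule.mul_induction_on' with
  | mem_mul_mem a ha b hb => rw [← mul_assoc]; exact Submodule.mul_mem_mul (hx a ha) hb
  | add a _ b _ h1 h2 => rw [mul_add]; exact add_mem h1 h2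

theorem mem_Lam (I : Ideal R) (x : K) : x ∈ Lam K I ↔ ∃ n : ℕ, x ∈ powK K I n / powK K I n :=
  Submodule.mem_iSup_of_directed _ (powK_div_powK_mono K I).directed_le

end IdealInvariants

end BlowUp

end

open scoped Polynomial PowerSeries

noncomputable section

namespace BlowUp

/-! ### Lengths of subquotients -/

section Length

variable {R M N : Type*} [CommRing R] [AddCommGroup M] [Module R M] [AddCommGroup N] [Module R N]

theorem length_subquotient_add {A B C : Submodule R M} (hCB : C ≤ B) (hBA : B ≤ A) :
    Module.length R (A ⧸ C.submoduleOf A) =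
      Module.length R (A ⧸ B.submoduleOf A) + Module.length R (B ⧸ C.submoduleOf B) := by
  have h1 : C.submoduleOf B ≤ (C.submoduleOf A).comap (Submodule.inclusion hBA) := by
    intro x hx
    simpa [Submodule.submoduleOf] using hx
  have h2 : C.submoduleOf A ≤ B.submoduleOf A := fun x hx => hCB hx
  rw [add_comm]
  refine Module.length_eq_add_of_exact
    (Submodule.mapQ _ _ (Submodule.inclusion hBA) h1) (Submodule.factor h2) ?_
    (Submodule.factor_surjective h2) ?_
  · rw [← LinearMap.ker_eq_bot, LinearMap.ker_eq_bot']
    intro x hx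
    obtain ⟨x, rfl⟩ := Submodule.Quotient.mk_surjective _ x
    rw [Submodule.mapQ_apply, Submodule.Quotient.mk_eq_zero] at hx
    exact (Submodule.Quotient.mk_eq_zero _).2 hx
  · intro y
    obtain ⟨y, rfl⟩ := Submodule.Quotient.mk_surjective _ y
    change Submodule.Quotient.mk y = (0 : A ⧸ B.submoduleOf A) ↔ _
    rw [Submodule.Quotient.mk_eq_zero]
    constructor
    · intro hy
      exact ⟨Submodule.Quotient.mk ⟨y, hy⟩, rfl⟩
    · rintro ⟨z, hz⟩
      obtain ⟨z, rfl⟩ := Submodule.Quotient.mk_surjective _ z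
      rw [Submodule.mapQ_apply, Submodule.Quotient.eq] at hz
      have h3 := sub_mem (show (Submodule.inclusion hBA z) ∈ B.submoduleOf A from z.2) (h2 hz)
      simpa using h3

theorem length_subquotient_map {f : M →ₗ[R] N} (hf : Function.Injective f) (A B : Submodule R M) :
    Module.length R (A.map f ⧸ (B.map f).submoduleOf (A.map f)) =
      Module.length R (A ⧸ B.submoduleOf A) := by
  refine (Submodule.Quotient.equiv _ _ (Submodule.equivMapOfInjective f hf A) ?_).length_eq.symm
  ext ⟨y, hy⟩
  constructor
  · rintro ⟨x, hx, hxy⟩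
    exact ⟨x, hx, congrArg Subtype.val hxy⟩
  · rintro ⟨x, hx, hxy⟩
    obtain ⟨a, ha, hay⟩ := hy
    obtain rfl : a = x := hf (hay.trans hxy.symm)
    exact ⟨⟨a, ha⟩, hx, Subtype.ext hay⟩

theorem length_subquotient_le {A B A' B' : Submodule R M} (hA : A ≤ A') (hB : B ≤ B')
    (h : A ⊓ B' ≤ B) :
    Module.length R (A ⧸ B.submoduleOf A) ≤ Module.length R (A' ⧸ B'.submoduleOf A') := by
  have h1 : B.submoduleOf A ≤ (B'.submoduleOf A').comap (Submodule.inclusion hA) :=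
    fun x hx => hB hx
  refine Module.length_le_of_injective (Submodule.mapQ _ _ (Submodule.inclusion hA) h1) ?_
  rw [← LinearMap.ker_eq_bot, LinearMap.ker_eq_bot']
  intro x hx
  obtain ⟨x, rfl⟩ := Submodule.Quotient.mk_surjective _ x
  rw [Submodule.mapQ_apply, Submodule.Quotient.mk_eq_zero] at hx
  exact (Submodule.Quotient.mk_eq_zero _).2 (h ⟨x.2, hx⟩)

theorem length_subquotient_eq_zero {A B : Submodule R M} (h : A ≤ B) :
    Module.length R (A ⧸ B.submoduleOf A) = 0 := by
  have : Subsingleton (A ⧸ B.submoduleOf A) := by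
    rw [Submodule.Quotient.subsingleton_iff, eq_top_iff]
    exact fun x _ => h x.2
  exact Module.length_eq_zero

theorem length_subquotient_eq_one {A B : Submodule R M} {y : M} (hyA : y ∈ A) (hyB : y ∉ B)
    (h : ∀ x ∈ A, x ∉ B → ∀ z ∈ A, ∃ r : R, z - r • x ∈ B) :
    Module.length R (A ⧸ B.submoduleOf A) = 1 := by
  rw [Module.length_eq_one_iff, isSimpleModule_iff_toSpanSingleton_surjective]
  refine ⟨⟨Submodule.Quotient.mk ⟨y, hyA⟩, 0, ?_⟩, ?_⟩
  · rw [Ne, Submodule.Quotient.mk_eq_zero]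
    exact hyB
  · intro x hx z
    obtain ⟨x, rfl⟩ := Submodule.Quotient.mk_surjective _ x
    obtain ⟨z, rfl⟩ := Submodule.Quotient.mk_surjective _ z
    rw [Ne, Submodule.Quotient.mk_eq_zero] at hx
    obtain ⟨r, hr⟩ := h x x.2 hx z z.2
    refine ⟨r, ?_⟩
    rw [LinearMap.toSpanSingleton_apply, ← Submodule.Quotient.mk_smul, eq_comm,
      Submodule.Quotient.eq]
    exact hr

end Length

section Submodules

variable {R : Type*} [CommRing R] {K : Type*} [Field K] [Algebra R K]

variable (R K) in
/-- The colength of `A` in the integral closure. -/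
def colen (A : Submodule R K) : ℤ := len (intCl R K) A

theorem colen_intCl : colen R K (intCl R K) = 0 := by
  rw [colen, len, length_subquotient_eq_zero le_rfl]
  rfl

/-- The submodule `x A`. -/
def scale (x : K) (A : Submodule R K) : Submodule R K := A.map (LinearMap.mulLeft R x)

theorem mem_scale {x : K} {A : Submodule R K} {y : K} : y ∈ scale x A ↔ ∃ a ∈ A, x * a = y :=
  Iff.rfl

theorem scale_mul (x y : K) (A : Submodule R K) : scale (x * y) A = scale x (scale y A) := by
  ext z
  simp [mem_scale, mul_assoc]

end Submodules

/-! ### The valuation -/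

section Valuation

variable {R : Type*} [CommRing R] [IsDomain R] {K : Type*} [Field K] [Algebra R K]
  [IsFractionRing R K] [IsDiscreteValuationRing (integralClosure R K)]

theorem val_le_one_iff {x : K} : val R K x ≤ 1 ↔ x ∈ intCl R K := by
  have := isFractionRing_intCl R K
  constructor
  · intro hx
    have h := IsDedekindDomain.HeightOneSpectrum.mem_integers_of_valuation_le_one
      (R := integralClosure R K) K x fun v => ?_
    · obtain ⟨y, rfl⟩ := h
      exact y.2
    · have hv : v = IsDiscreteValuationRing.maximalIdeal (integralClosure R K) :=
        IsDedekindDomain.HeightOneSpectrum.ext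
          (IsLocalRing.eq_maximalIdeal (v.isPrime.isMaximal v.ne_bot))
      rw [hv]
      exact hx
  · intro hx
    exact (IsDiscreteValuationRing.maximalIdeal (integralClosure R K)).valuation_le_one
      (K := K) ⟨x, hx⟩

theorem exists_val_sub_lt_one (hres : ResiduallyRational R K) {z : K} (hz : z ∈ intCl R K) :
    ∃ r : R, val R K (z - algebraMap R K r) < 1 := by
  have := isFractionRing_intCl R K
  obtain ⟨r, hr⟩ := hres (IsLocalRing.residue (integralClosure R K) ⟨z, hz⟩)
  refine ⟨r, ?_⟩
  rw [RingHom.comp_apply, eq_comm, ← sub_eq_zero, ← map_sub, IsLocalRing.residue_eq_zero_iff] at hr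
  exact ((IsDiscreteValuationRing.maximalIdeal
    (integralClosure R K)).valuation_lt_one_iff_mem (K := K) _).2 hr

theorem exists_val_eq_exp {x : K} (hx : x ≠ 0) : ∃ n : ℤ, val R K x = WithZero.exp (-n) :=
  ⟨-(val R K x).log, by rw [neg_neg, WithZero.exp_log (by simpa using hx)]⟩

theorem ne_zero_of_val_eq_exp {x : K} {n : ℤ} (hx : val R K x = WithZero.exp n) : x ≠ 0 := by
  rintro rfl
  rw [map_zero] at hx
  exact WithZero.exp_ne_zero hx.symm

theorem val_lt_exp_iff {x : K} {m : ℤ} :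
    val R K x < WithZero.exp (-m) ↔ val R K x ≤ WithZero.exp (-(m + 1)) := by
  rcases eq_or_ne x 0 with rfl | hx
  · simp
  · obtain ⟨n, hn⟩ := exists_val_eq_exp (R := R) hx
    rw [hn, WithZero.exp_lt_exp, WithZero.exp_le_exp]
    omega

variable (R K) in
theorem exists_val_eq_exp_neg (n : ℕ) : ∃ x : K, val R K x = WithZero.exp (-(n : ℤ)) := by
  have := isFractionRing_intCl R K
  obtain ⟨t, ht⟩ := (IsDiscreteValuationRing.maximalIdeal
    (integralClosure R K)).valuation_exists_uniformizer K
  refine ⟨t ^ n, ?_⟩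
  rw [map_pow]
  refine (congrArg (· ^ n) ht).trans ?_
  simp only [← WithZero.exp_nsmul]
  simp

/-- The elements of `J` of value at least `m`. -/
def cut (J : Submodule R K) (m : ℤ) : Submodule R K where
  carrier := {x | x ∈ J ∧ val R K x ≤ WithZero.exp (-m)}
  zero_mem' := ⟨zero_mem _, by simp⟩
  add_mem' := fun ha hb => ⟨add_mem ha.1 hb.1, (val R K).map_add_le ha.2 hb.2⟩
  smul_mem' := fun a x hx => ⟨Submodule.smul_mem _ a hx.1, by
    rw [Algebra.smul_def, map_mul]
    exact (mul_le_of_le_one_left' (val_algebraMap_le_one R K a)).trans hx.2⟩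

theorem mem_cut {J : Submodule R K} {m : ℤ} {x : K} :
    x ∈ cut J m ↔ x ∈ J ∧ val R K x ≤ WithZero.exp (-m) := Iff.rfl

theorem cut_anti (J : Submodule R K) {m n : ℤ} (h : m ≤ n) : cut J n ≤ cut J m := fun _ hx =>
  ⟨hx.1, hx.2.trans (WithZero.exp_le_exp.2 (by omega))⟩

theorem filt_eq_cut (i : ℕ) : filt R K i = cut (base R K) (semi R K i) := rfl

theorem cut_top_zero : cut (⊤ : Submodule R K) 0 = intCl R K := by
  ext x
  rw [mem_cut, ← val_le_one_iff]
  simp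

theorem length_cut_of_notMem {J : Submodule R K} {m : ℤ} (hm : m ∉ valueSet J) :
    Module.length R (cut J m ⧸ (cut J (m + 1)).submoduleOf (cut J m)) = 0 := by
  refine length_subquotient_eq_zero fun x hx => ⟨hx.1, ?_⟩
  rw [← val_lt_exp_iff]
  exact lt_of_le_of_ne hx.2 fun h => hm ⟨x, hx.1, h⟩

theorem exists_sub_smul_mem_cut (hres : ResiduallyRational R K) {J : Submodule R K} {m : ℤ}
    {x z : K} (hx : x ∈ J) (hxm : val R K x = WithZero.exp (-m)) (hz : z ∈ cut J m) :
    ∃ r : R, z - r • x ∈ cut J (m + 1) := by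
  have hx0 : x ≠ 0 := ne_zero_of_val_eq_exp hxm
  have h : z / x ∈ intCl R K := by
    rw [← val_le_one_iff, map_div₀, hxm]
    exact div_le_one_of_le₀ hz.2 zero_le
  obtain ⟨r, hr⟩ := exists_val_sub_lt_one hres h
  refine ⟨r, sub_mem hz.1 (J.smul_mem r hx), ?_⟩
  rw [← val_lt_exp_iff]
  have e : z - r • x = (z / x - algebraMap R K r) * x := by
    rw [sub_mul, div_mul_cancel₀ _ hx0, Algebra.smul_def]
  rw [e, map_mul, hxm]
  calc _ < 1 * WithZero.exp (-m) := mul_lt_mul_of_pos_right hr WithZero.exp_pos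
    _ = _ := one_mul _

theorem length_cut_of_mem (hres : ResiduallyRational R K) {J : Submodule R K} {m : ℤ}
    (hm : m ∈ valueSet J) :
    Module.length R (cut J m ⧸ (cut J (m + 1)).submoduleOf (cut J m)) = 1 := by
  obtain ⟨y, hyJ, hy⟩ := hm
  refine length_subquotient_eq_one (y := y) ⟨hyJ, hy.le⟩ (fun h => ?_) ?_
  · have := h.2
    rw [← val_lt_exp_iff] at this
    exact this.ne hy
  · intro x hx hx' z hz
    refine exists_sub_smul_mem_cut hres hx.1 (le_antisymm hx.2 (le_of_not_gt fun h => hx' ?_)) hz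
    exact ⟨hx.1, val_lt_exp_iff.1 h⟩

/-! ### Colengths in the integral closure -/

/-- The submodules of the integral closure that contain all elements of large value. -/
def IsBig (A : Submodule R K) : Prop := A ≤ intCl R K ∧ ∃ n : ℕ, cut ⊤ (n : ℤ) ≤ A

theorem isBig_intCl : IsBig (intCl R K) := ⟨le_rfl, 0, cut_top_zero.le⟩

theorem IsBig.mono {A B : Submodule R K} (hA : IsBig A) (hAB : A ≤ B) (hB : B ≤ intCl R K) :
    IsBig B := ⟨hB, hA.2.imp fun _ h => h.trans hAB⟩

theorem length_intCl_cut_ne_top (hres : ResiduallyRational R K) (n : ℕ) :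
    Module.length R (intCl R K ⧸ (cut ⊤ (n : ℤ)).submoduleOf (intCl R K)) ≠ ⊤ := by
  induction n with
  | zero =>
    rw [length_subquotient_eq_zero (by rw [Nat.cast_zero, cut_top_zero])]
    exact ENat.zero_ne_top
  | succ n ih =>
    have h : cut (⊤ : Submodule R K) (n : ℤ) ≤ intCl R K := by
      rw [← cut_top_zero]
      exact cut_anti _ (by omega)
    push_cast
    rw [length_subquotient_add (cut_anti _ (by omega)) h]
    refine WithTop.add_ne_top.2 ⟨ih, ?_⟩
    by_cases hm : (n : ℤ) ∈ valueSet (⊤ : Submodule R K)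
    · rw [length_cut_of_mem hres hm]
      exact ENat.one_ne_top
    · rw [length_cut_of_notMem hm]
      exact ENat.zero_ne_top

theorem IsBig.length_ne_top (hres : ResiduallyRational R K) {A B : Submodule R K}
    (hA : A ≤ intCl R K) (hB : IsBig B) : Module.length R (A ⧸ B.submoduleOf A) ≠ ⊤ := by
  obtain ⟨hBS, n, hn⟩ := hB
  have h1 := length_intCl_cut_ne_top hres n
  rw [length_subquotient_add hn hBS] at h1
  refine ne_top_of_le_ne_top (WithTop.add_ne_top.1 h1).1 ?_
  have h2 : Module.length R (A ⧸ B.submoduleOf A) =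
      Module.length R (A ⧸ (A ⊓ B).submoduleOf A) := by
    have : B.submoduleOf A = (A ⊓ B).submoduleOf A := by
      ext x
      simp [Submodule.submoduleOf]
    rw [this]
  rw [h2]
  exact length_subquotient_le hA inf_le_right le_rfl

theorem len_eq_colen_sub (hres : ResiduallyRational R K) {A B : Submodule R K} (hB : IsBig B)
    (hBA : B ≤ A) (hA : A ≤ intCl R K) : (len A B : ℤ) = colen R K B - colen R K A := by
  have h := length_subquotient_add hBA hA
  have h1 := hB.length_ne_top hres hA
  have h2 := (hB.mono hBA hA).length_ne_top hres le_rfl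
  rw [colen, colen, len, len, len, h, ENat.toNat_add h2 h1]
  push_cast
  ring

theorem len_le_len (hres : ResiduallyRational R K) {A B A' B' : Submodule R K} (hA : A ≤ A')
    (hB : B ≤ B') (h : A ⊓ B' ≤ B) (hA' : A' ≤ intCl R K) (hB' : IsBig B') :
    len A B ≤ len A' B' :=
  ENat.toNat_le_toNat (length_subquotient_le hA hB h) (hB'.length_ne_top hres hA')

theorem eq_of_colen_eq (hres : ResiduallyRational R K) {A B : Submodule R K} (hB : IsBig B)
    (hBA : B ≤ A) (hA : A ≤ intCl R K) (h : colen R K A = colen R K B) : A = B := by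
  have h1 : (len A B : ℤ) = 0 := by rw [len_eq_colen_sub hres hB hBA hA, h, sub_self]
  have h2 : Module.length R (A ⧸ B.submoduleOf A) = 0 := by
    rw [Nat.cast_eq_zero, len, ENat.toNat_eq_zero] at h1
    exact h1.resolve_right (hB.length_ne_top hres hA)
  rw [Module.length_eq_zero_iff, Submodule.Quotient.subsingleton_iff,
    Submodule.submoduleOf_eq_top] at h2
  exact le_antisymm h2 hBA

theorem exists_cut_le_of_mul_mem {A : Submodule R K} {g : K} (hg0 : g ≠ 0)
    (h : ∀ s ∈ intCl R K, g * s ∈ A) : ∃ n : ℕ, cut ⊤ (n : ℤ) ≤ A := by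
  obtain ⟨m, hm⟩ := exists_val_eq_exp (R := R) hg0
  refine ⟨m.toNat, fun z hz => ?_⟩
  have hz' : z / g ∈ intCl R K := by
    rw [← val_le_one_iff, map_div₀, hm]
    refine div_le_one_of_le₀ (hz.2.trans (WithZero.exp_le_exp.2 ?_)) zero_le
    have := Int.self_le_toNat m
    omega
  have := h _ hz'
  rwa [mul_div_cancel₀ _ hg0] at this

theorem IsBig.scale {x : K} (hx : x ∈ intCl R K) (hx0 : x ≠ 0) {A : Submodule R K}
    (hA : IsBig A) : IsBig (scale x A) := by
  obtain ⟨hAS, n, hn⟩ := hA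
  refine ⟨?_, ?_⟩
  · rintro _ ⟨a, ha, rfl⟩
    exact (integralClosure R K).mul_mem hx (hAS ha)
  · obtain ⟨t, ht⟩ := exists_val_eq_exp_neg R K n
    have ht0 : t ≠ 0 := ne_zero_of_val_eq_exp ht
    refine exists_cut_le_of_mul_mem (g := x * t)
      (mul_ne_zero hx0 ht0) fun s hs => ⟨t * s, hn ⟨trivial, ?_⟩, (mul_assoc _ _ _).symm⟩
    rw [map_mul, ht]
    exact mul_le_of_le_one_right' (val_le_one_iff.2 hs)

theorem colen_scale (hres : ResiduallyRational R K) {x : K} (hx : x ∈ intCl R K) (hx0 : x ≠ 0)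
    {A : Submodule R K} (hA : IsBig A) :
    colen R K (scale x A) = colen R K A + colen R K (scale x (intCl R K)) := by
  have h := len_eq_colen_sub hres (A := scale x (intCl R K)) (hA.scale hx hx0)
    (Submodule.map_mono hA.1) (isBig_intCl.scale hx hx0).1
  have h' : len (scale x (intCl R K)) (scale x A) = len (intCl R K) A := by
    rw [len, len, scale, scale, length_subquotient_map]
    intro a b hab
    exact mul_left_cancel₀ hx0 hab
  rw [h'] at h
  change colen R K A = _ at h
  linarith

theorem colen_scale_pow (hres : ResiduallyRational R K) {x : K} (hx : x ∈ intCl R K) (hx0 : x ≠ 0)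
    {A : Submodule R K} (hA : IsBig A) (n : ℕ) :
    colen R K (scale (x ^ n) A) = colen R K A + n * colen R K (scale x (intCl R K)) := by
  induction n with
  | zero =>
    have : scale (1 : K) A = A := by
      ext z
      simp [mem_scale]
    simp [this]
  | succ n ih =>
    rw [pow_succ', scale_mul, colen_scale hres hx hx0
      (hA.scale ((integralClosure R K).pow_mem hx n) (pow_ne_zero n hx0)), ih]
    push_cast
    ring

end Valuation

/-! ### Duals -/

section Dual

variable {R : Type*} [CommRing R] {K : Type*} [Field K] [Algebra R K]

theorem mem_dual {J : Submodule R K} {x : K} : x ∈ dual J ↔ ∀ y ∈ J, x * y ∈ base R K :=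
  Submodule.mem_div_iff_forall_mul_mem

theorem dual_anti {A B : Submodule R K} (h : A ≤ B) : dual B ≤ dual A := fun _ hx =>
  mem_dual.2 fun y hy => mem_dual.1 hx y (h hy)

theorem le_dual_dual (J : Submodule R K) : J ≤ dual (dual J) := fun x hx =>
  mem_dual.2 fun y hy => by
    rw [mul_comm]
    exact mem_dual.1 hy x hx

theorem base_le_intCl : base R K ≤ intCl R K := by
  intro x hx
  obtain ⟨r, rfl⟩ := Submodule.mem_one.1 hx
  exact (integralClosure R K).algebraMap_mem r

theorem one_mem_base : (1 : K) ∈ base R K := Submodule.mem_one.2 ⟨1, map_one _⟩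

theorem dual_le_base {J : Submodule R K} (h : 1 ∈ J) : dual J ≤ base R K := fun x hx => by
  simpa using mem_dual.1 hx 1 h

theorem dual_base : dual (base R K) = base R K :=
  le_antisymm (dual_le_base one_mem_base) fun x hx => mem_dual.2 fun y hy => by
    simpa using Submodule.mul_mem_mul hx hy

theorem base_le_dual {J : Submodule R K} (h : J ≤ base R K) : base R K ≤ dual J :=
  dual_base.ge.trans (dual_anti h)

theorem dual_scale {x : K} (hx : x ≠ 0) (J : Submodule R K) :
    dual (scale x J) = scale x⁻¹ (dual J) := by
  ext y
  rw [mem_dual, mem_scale]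
  constructor
  · intro h
    refine ⟨x * y, mem_dual.2 fun z hz => ?_, by rw [inv_mul_cancel_left₀ hx]⟩
    have := h (x * z) ⟨z, hz, rfl⟩
    rwa [show x * y * z = y * (x * z) by ring]
  · rintro ⟨a, ha, rfl⟩ _ ⟨z, hz, rfl⟩
    have := mem_dual.1 ha z hz
    rwa [LinearMap.mulLeft_apply, show x⁻¹ * a * (x * z) = (x⁻¹ * x) * (a * z) by ring,
      inv_mul_cancel₀ hx, one_mul]

theorem conductor_le_base : conductor R K ≤ base R K :=
  dual_le_base (integralClosure R K).one_mem

theorem mul_mem_conductor {g s : K} (hg : g ∈ conductor R K) (hs : s ∈ intCl R K) :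
    g * s ∈ conductor R K :=
  mem_dual.2 fun y hy => by
    rw [mul_assoc]
    exact mem_dual.1 hg _ ((integralClosure R K).mul_mem hs hy)

end Dual

theorem sum_Icc_one_sub (f : ℕ → ℤ) (n : ℕ) :
    ∑ i ∈ Finset.Icc 1 n, (f i - f (i - 1)) = f n - f 0 := by
  induction n with
  | zero => simp
  | succ n ih =>
    rw [Finset.sum_Icc_succ_top (by omega), ih, Nat.add_sub_cancel]
    ring

/-! ### The conductor and the value semigroup -/

section Semigroup

theorem exists_mem_conductor_ne_zero (R : Type*) [CommRing R] [IsDomain R] (K : Type*) [Field K]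
    [Algebra R K] [IsFractionRing R K] [Module.Finite R (integralClosure R K)] :
    ∃ g ∈ conductor R K, g ≠ 0 := by
  have hfg : (intCl R K).FG := by
    rw [← Submodule.fg_top, ← Module.finite_def]
    exact inferInstanceAs (Module.Finite R (integralClosure R K))
  obtain ⟨a, ha, h⟩ := FractionalIdeal.isFractional_of_fg (S := nonZeroDivisors R) hfg
  refine ⟨algebraMap R K a, mem_dual.2 fun y hy => ?_, ?_⟩
  · obtain ⟨r, hr⟩ := h y hy
    exact Submodule.mem_one.2 ⟨r, by rw [hr, Algebra.smul_def]⟩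
  · exact IsFractionRing.to_map_ne_zero_of_mem_nonZeroDivisors ha

variable {R : Type*} [CommRing R] [IsDomain R] {K : Type*} [Field K] [Algebra R K]
  [IsFractionRing R K] [IsDiscreteValuationRing (integralClosure R K)]

theorem cut_eq_self {J : Submodule R K} (hJ : J ≤ intCl R K) : cut J 0 = J :=
  le_antisymm (fun _ hx => hx.1) fun x hx => ⟨hx, by simpa using val_le_one_iff.2 (hJ hx)⟩

theorem IsBig.cut {J : Submodule R K} (hJ : IsBig J) (m : ℕ) : IsBig (cut J (m : ℤ)) := by
  obtain ⟨hJ, n, hn⟩ := hJ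
  refine ⟨fun x hx => hJ hx.1, max n m, fun x hx => ⟨hn (cut_anti _ ?_ hx), ?_⟩⟩
  · exact_mod_cast le_max_left n m
  · exact hx.2.trans (WithZero.exp_le_exp.2 (neg_le_neg (by exact_mod_cast le_max_right n m)))

theorem nonneg_of_mem_valueSet {J : Submodule R K} (hJ : J ≤ intCl R K) {m : ℤ}
    (hm : m ∈ valueSet J) : 0 ≤ m := by
  obtain ⟨x, hx, h⟩ := hm
  have := val_le_one_iff.2 (hJ hx)
  rw [h, ← WithZero.exp_zero, WithZero.exp_le_exp] at this
  omega

theorem semi_zero : semi R K 0 = 0 := by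
  rw [semi, Nat.nth_zero]
  refine Nat.sInf_eq_zero.2 (Or.inl ⟨1, one_mem_base, ?_⟩)
  simp

theorem exists_semi_eq {m : ℕ} (hm : (m : ℤ) ∈ valueSet (base R K)) : ∃ i, semi R K i = m := by
  classical
  exact ⟨_, Nat.nth_count hm⟩

theorem filt_le_base (i : ℕ) : filt R K i ≤ base R K := fun _ hx => hx.1

variable [Module.Finite R (integralClosure R K)]

variable (R K) in
theorem isBig_conductor : IsBig (conductor R K) := by
  obtain ⟨g, hg, hg0⟩ := exists_mem_conductor_ne_zero R K
  exact ⟨conductor_le_base.trans base_le_intCl,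
    exists_cut_le_of_mul_mem hg0 fun s hs => mul_mem_conductor hg hs⟩

theorem isBig_base : IsBig (base R K) :=
  (isBig_conductor R K).mono conductor_le_base base_le_intCl

variable (R K) in
theorem exists_conductor_eq_cut :
    ∃ c : ℕ, conductor R K = cut ⊤ (c : ℤ) ∧ (c : ℤ) ∈ valueSet (conductor R K) := by
  classical
  have hex : ∃ n : ℕ, (n : ℤ) ∈ valueSet (conductor R K) := by
    obtain ⟨g, hg, hg0⟩ := exists_mem_conductor_ne_zero R K
    obtain ⟨m, hm⟩ := exists_val_eq_exp (R := R) hg0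
    have hm' : m ∈ valueSet (conductor R K) := ⟨g, hg, hm⟩
    lift m to ℕ using nonneg_of_mem_valueSet (isBig_conductor R K).1 hm'
    exact ⟨m, hm'⟩
  refine ⟨Nat.find hex, le_antisymm ?_ ?_, Nat.find_spec hex⟩
  · refine fun x hx => ⟨trivial, ?_⟩
    rcases eq_or_ne x 0 with rfl | hx0
    · simp
    · obtain ⟨m, hm⟩ := exists_val_eq_exp (R := R) hx0
      have hm' : m ∈ valueSet (conductor R K) := ⟨x, hx, hm⟩
      lift m to ℕ using nonneg_of_mem_valueSet (isBig_conductor R K).1 hm'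
      have := Nat.find_min' hex hm'
      rw [hm, WithZero.exp_le_exp]
      omega
  · intro z hz
    obtain ⟨g, hg, hgv⟩ := Nat.find_spec hex
    have hz' : z / g ∈ intCl R K := by
      rw [← val_le_one_iff, map_div₀, hgv]
      exact div_le_one_of_le₀ hz.2 zero_le
    have := mul_mem_conductor hg hz'
    rwa [mul_div_cancel₀ _ (ne_zero_of_val_eq_exp hgv)] at this

theorem dual_conductor : dual (conductor R K) = intCl R K := by
  obtain ⟨c, hc, g, hg, hgv⟩ := exists_conductor_eq_cut R K
  have hg0 := ne_zero_of_val_eq_exp hgv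
  refine le_antisymm (fun y hy => ?_) (le_dual_dual _)
  have h : y * g ∈ conductor R K := mem_dual.2 fun s hs => by
    rw [mul_assoc]
    exact mem_dual.1 hy _ (mul_mem_conductor hg hs)
  rw [hc] at h
  have h' := h.2
  rw [map_mul, hgv] at h'
  rw [← val_le_one_iff]
  by_contra! hlt
  refine h'.not_gt ?_
  calc _ = 1 * WithZero.exp (-(c : ℤ)) := (one_mul _).symm
    _ < _ := mul_lt_mul_of_pos_right hlt WithZero.exp_pos

variable (R K) in
theorem infinite_values : (Set.ofPred fun m : ℕ => (m : ℤ) ∈ valueSet (base R K)).Infinite := by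
  obtain ⟨c, hc, -⟩ := exists_conductor_eq_cut R K
  refine Set.infinite_of_forall_exists_gt fun n => ⟨max c (n + 1), ?_,
    (Nat.lt_succ_self n).trans_le (le_max_right _ _)⟩
  obtain ⟨x, hx⟩ := exists_val_eq_exp_neg R K (max c (n + 1))
  refine ⟨x, conductor_le_base (hc ▸ ⟨trivial, ?_⟩), hx⟩
  rw [hx, WithZero.exp_le_exp]
  have : (c : ℤ) ≤ (max c (n + 1) : ℕ) := by exact_mod_cast le_max_left c (n + 1)
  omega

theorem semi_mem (i : ℕ) : (semi R K i : ℤ) ∈ valueSet (base R K) :=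
  Nat.nth_mem_of_infinite (infinite_values R K) i

theorem semi_strictMono : StrictMono (semi R K) := Nat.nth_strictMono (infinite_values R K)

theorem cut_semi_add_one {J : Submodule R K} (hJ : J ≤ base R K) (i : ℕ) :
    cut J ((semi R K i : ℤ) + 1) = cut J (semi R K (i + 1)) := by
  have hlt := semi_strictMono (R := R) (K := K) (Nat.lt_add_one i)
  refine le_antisymm (fun x hx => ⟨hx.1, ?_⟩) (cut_anti _ (by omega))
  rcases eq_or_ne x 0 with rfl | hx0
  · simp
  obtain ⟨m, hm⟩ := exists_val_eq_exp (R := R) hx0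
  have hm' : m ∈ valueSet (base R K) := ⟨x, hJ hx.1, hm⟩
  lift m to ℕ using nonneg_of_mem_valueSet base_le_intCl hm'
  obtain ⟨j, rfl⟩ := exists_semi_eq hm'
  have h := hx.2
  rw [hm, WithZero.exp_le_exp] at h
  have hij : i < j := (semi_strictMono (R := R) (K := K)).lt_iff_lt.1 (by omega)
  have := (semi_strictMono (R := R) (K := K)).monotone (Nat.succ_le_of_lt hij)
  rw [hm, WithZero.exp_le_exp]
  simp only [Nat.succ_eq_add_one] at this
  omega

open Classical in
theorem colen_cut_succ_sub (hres : ResiduallyRational R K) {J : Submodule R K} (hJ : J ≤ base R K)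
    (hJb : IsBig J) (i : ℕ) :
    colen R K (cut J (semi R K (i + 1))) - colen R K (cut J (semi R K i)) =
      if (semi R K i : ℤ) ∈ valueSet J then 1 else 0 := by
  rw [← len_eq_colen_sub hres (hJb.cut _) (cut_anti _ ?_) (hJb.cut _).1, ← cut_semi_add_one hJ, len]
  · split_ifs with h
    · rw [length_cut_of_mem hres h]
      rfl
    · rw [length_cut_of_notMem h]
      rfl
  · exact_mod_cast (semi_strictMono (R := R) (K := K)).monotone i.le_succ

theorem colen_filt (hres : ResiduallyRational R K) (i : ℕ) :
    colen R K (filt R K i) = colen R K (base R K) + i := by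
  induction i with
  | zero => rw [filt_eq_cut, semi_zero, Nat.cast_zero, cut_eq_self base_le_intCl]; simp
  | succ i ih =>
    have := colen_cut_succ_sub hres le_rfl (isBig_base (R := R) (K := K)) i
    rw [if_pos (semi_mem i), ← filt_eq_cut, ← filt_eq_cut] at this
    push_cast
    linarith

theorem conductor_eq_cut_semi (hres : ResiduallyRational R K) :
    conductor R K = cut ⊤ (semi R K (typeLength R K) : ℤ) := by
  obtain ⟨c, hc, g, hg, hgv⟩ := exists_conductor_eq_cut R K
  obtain ⟨j, rfl⟩ := exists_semi_eq ⟨g, conductor_le_base hg, hgv⟩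
  have h1 : conductor R K = filt R K j := by
    refine le_antisymm ?_ ?_
    · intro x hx
      refine ⟨conductor_le_base hx, ?_⟩
      rw [hc] at hx
      exact hx.2
    · intro x hx
      rw [hc]
      exact ⟨trivial, hx.2⟩
  have h2 : (typeLength R K : ℤ) = j := by
    rw [typeLength, len_eq_colen_sub hres (isBig_conductor R K) conductor_le_base base_le_intCl, h1,
      colen_filt hres]
    ring
  rwa [Nat.cast_injective h2]

theorem cut_semi_typeLength (hres : ResiduallyRational R K) {J : Submodule R K}
    (hJ : conductor R K ≤ J) : cut J (semi R K (typeLength R K) : ℤ) = conductor R K := by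
  rw [conductor_eq_cut_semi hres] at hJ ⊢
  exact le_antisymm (fun x hx => ⟨trivial, hx.2⟩) fun x hx => ⟨hJ hx, hx.2⟩

theorem conductor_le_cut_semi (hres : ResiduallyRational R K) {J : Submodule R K}
    (hJ : conductor R K ≤ J) {i : ℕ} (hi : i ≤ typeLength R K) :
    conductor R K ≤ cut J (semi R K i : ℤ) := by
  rw [← cut_semi_typeLength hres hJ]
  exact cut_anti _ (by exact_mod_cast (semi_strictMono (R := R) (K := K)).monotone hi)

theorem dual_le_intCl {J : Submodule R K} (hJ : conductor R K ≤ J) : dual J ≤ intCl R K :=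
  (dual_anti hJ).trans dual_conductor.le

theorem isBig_dual {J : Submodule R K} (hJ : conductor R K ≤ J) (hJR : J ≤ base R K) :
    IsBig (dual J) := isBig_base.mono (base_le_dual hJR) (dual_le_intCl hJ)

theorem colen_eq_card_Gam (hres : ResiduallyRational R K) {J : Submodule R K}
    (hJ : conductor R K ≤ J) (hJR : J ≤ base R K) :
    colen R K J = colen R K (base R K) + (Finset.Icc 1 (typeLength R K) \ Gam J).card := by
  classical
  have hJb := (isBig_conductor R K).mono hJ (hJR.trans base_le_intCl)
  have h1 := sum_Icc_one_sub (fun i => colen R K (cut J (semi R K i))) (typeLength R K)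
  have h2 : ∑ i ∈ Finset.Icc 1 (typeLength R K),
      (colen R K (cut J (semi R K i)) - colen R K (cut J (semi R K (i - 1)))) = (Gam J).card := by
    rw [Gam, Finset.card_filter]
    push_cast
    refine Finset.sum_congr rfl fun i hi => ?_
    obtain ⟨j, rfl⟩ := Nat.exists_eq_add_of_le' (Finset.mem_Icc.1 hi).1
    rw [Nat.add_sub_cancel, colen_cut_succ_sub hres hJR hJb]
  rw [h2, cut_semi_typeLength hres hJ, semi_zero, Nat.cast_zero,
    cut_eq_self (hJR.trans base_le_intCl)] at h1
  have h3 : colen R K (conductor R K) = colen R K (base R K) + typeLength R K := by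
    rw [typeLength, len_eq_colen_sub hres (isBig_conductor R K) conductor_le_base base_le_intCl]
    ring
  have h4 : (Gam J) ⊆ Finset.Icc 1 (typeLength R K) := Finset.filter_subset _ _
  have h5 := Finset.card_sdiff_add_card_eq_card h4
  rw [Nat.card_Icc, Nat.add_sub_cancel] at h5
  have h6 : ((Finset.Icc 1 (typeLength R K) \ Gam J).card : ℤ) + (Gam J).card =
    typeLength R K := by exact_mod_cast h5
  linarith

/-! ### The type sequence -/

theorem filt_anti {i j : ℕ} (h : i ≤ j) : filt R K j ≤ filt R K i :=
  cut_anti _ (by exact_mod_cast (semi_strictMono (R := R) (K := K)).monotone h)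

theorem typeSeq_eq (hres : ResiduallyRational R K) {i : ℕ} (hi : i ≤ typeLength R K) :
    (typeSeq R K i : ℤ) =
      colen R K (dual (filt R K (i - 1))) - colen R K (dual (filt R K i)) := by
  have h := conductor_le_cut_semi hres (conductor_le_base (R := R) (K := K)) hi
  have h' := conductor_le_cut_semi hres (conductor_le_base (R := R) (K := K))
    ((Nat.sub_le i 1).trans hi)
  exact len_eq_colen_sub hres (isBig_dual h' (filt_le_base _)) (dual_anti (filt_anti (by omega)))
    (dual_le_intCl h)

theorem sum_typeSeq (hres : ResiduallyRational R K) :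
    ∑ i ∈ Finset.Icc 1 (typeLength R K), (typeSeq R K i : ℤ) = colen R K (base R K) := by
  have h1 := sum_Icc_one_sub (fun i => -colen R K (dual (filt R K i))) (typeLength R K)
  have h2 : filt R K (typeLength R K) = conductor R K :=
    cut_semi_typeLength hres conductor_le_base
  have h3 : filt R K 0 = base R K := by
    rw [filt_eq_cut, semi_zero, Nat.cast_zero, cut_eq_self base_le_intCl]
  rw [h2, h3, dual_conductor, colen_intCl, dual_base] at h1
  rw [Finset.sum_congr rfl fun i hi => typeSeq_eq hres (Finset.mem_Icc.1 hi).2]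
  calc _ = _ := Finset.sum_congr rfl fun i _ => by ring
    _ = _ := h1
    _ = _ := by ring

theorem typeSeq_le (hres : ResiduallyRational R K) {J : Submodule R K}
    (hJ : conductor R K ≤ J) (hJR : J ≤ base R K) {i : ℕ} (hi : i + 1 ≤ typeLength R K)
    (hiJ : (semi R K i : ℤ) ∈ valueSet J) :
    (typeSeq R K (i + 1) : ℤ) ≤
      colen R K (dual (cut J (semi R K i))) - colen R K (dual (cut J (semi R K (i + 1)))) := by
  obtain ⟨y, hyJ, hy⟩ := hiJ
  have h1 := conductor_le_cut_semi hres hJ hi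
  have h2 := conductor_le_cut_semi hres hJ ((Nat.le_succ i).trans hi)
  have hle : ∀ j : ℕ, cut J (semi R K j) ≤ filt R K j := fun j x hx => ⟨hJR hx.1, hx.2⟩
  have hbig : IsBig (dual (cut J (semi R K i))) :=
    isBig_dual h2 ((hle i).trans (filt_le_base i))
  have hmono : cut J (semi R K (i + 1)) ≤ cut J (semi R K i) :=
    cut_anti _ (by exact_mod_cast (semi_strictMono (R := R) (K := K)).monotone i.le_succ)
  rw [← len_eq_colen_sub hres hbig (dual_anti hmono) (dual_le_intCl h1), typeSeq,
    Nat.add_sub_cancel]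
  refine Nat.cast_le.2 (len_le_len hres (dual_anti (hle _)) (dual_anti (hle _)) ?_
    (dual_le_intCl h1) hbig)
  rintro z ⟨hz1, hz2⟩
  refine mem_dual.2 fun w hw => ?_
  obtain ⟨r, hr⟩ := exists_sub_smul_mem_cut hres (hJR hyJ) hy hw
  rw [cut_semi_add_one le_rfl] at hr
  have h3 := mem_dual.1 hz1 _ hr
  have h4 := mem_dual.1 hz2 (r • y) (Submodule.smul_mem _ r ⟨hyJ, hy.le⟩)
  have := add_mem h3 h4
  rwa [← mul_add, sub_add_cancel] at this

theorem dInv_nonneg (hres : ResiduallyRational R K) {J : Submodule R K}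
    (hJ : conductor R K ≤ J) (hJR : J ≤ base R K) : 0 ≤ dInv J := by
  classical
  have h1 := sum_Icc_one_sub (fun i => -colen R K (dual (cut J (semi R K i)))) (typeLength R K)
  rw [cut_semi_typeLength hres hJ, dual_conductor, colen_intCl, semi_zero, Nat.cast_zero,
    cut_eq_self (hJR.trans base_le_intCl)] at h1
  have hd : dInv J = colen R K (dual J) - ∑ i ∈ Gam J, (typeSeq R K i : ℤ) := rfl
  rw [hd, Gam, Finset.sum_filter, sub_nonneg]
  calc _ ≤ _ := Finset.sum_le_sum fun i hi => ?_
    _ = _ := h1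
    _ = _ := by ring
  obtain ⟨hi1, hi2⟩ := Finset.mem_Icc.1 hi
  obtain ⟨j, rfl⟩ := Nat.exists_eq_add_of_le' hi1
  rw [Nat.add_sub_cancel]
  split_ifs with h
  · have := typeSeq_le hres hJ hJR hi2 h
    linarith
  · have hmono : cut J (semi R K (j + 1)) ≤ cut J (semi R K j) :=
      cut_anti _ (by exact_mod_cast (semi_strictMono (R := R) (K := K)).monotone j.le_succ)
    have h2 := conductor_le_cut_semi hres hJ ((Nat.le_succ j).trans hi2)
    have := len_eq_colen_sub hres (isBig_dual h2 fun x hx => hJR hx.1) (dual_anti hmono)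
      (dual_le_intCl (conductor_le_cut_semi hres hJ hi2))
    have h3 := Int.natCast_nonneg (len (dual (cut J (semi R K (j + 1))))
      (dual (cut J (semi R K j))))
    linarith

end Semigroup

/-! ### The Hilbert function and the `h`-polynomial -/

section Hilbert

variable {R : Type*} [CommRing R]

theorem hPolynomial_eq {I : Ideal R} {N : ℕ} {e : ℤ}
    (h : ∀ n ≥ N, (hilbertFunction I n : ℤ) = e) :
    hPolynomial I = (1 - Polynomial.X) * (∑ n ∈ Finset.range N,
      Polynomial.C (hilbertFunction I n : ℤ) * Polynomial.X ^ n) +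
      Polynomial.C e * Polynomial.X ^ N := by
  set T : ℤ[X] := ∑ n ∈ Finset.range N, Polynomial.C (hilbertFunction I n : ℤ) * Polynomial.X ^ n
    with hT
  have hs : hilbertSeries I =
      (T : ℤ⟦X⟧) + PowerSeries.C e * PowerSeries.X ^ N * PowerSeries.mk 1 := by
    ext n
    rw [hilbertSeries, PowerSeries.coeff_mk, map_add, mul_assoc, PowerSeries.coeff_C_mul,
      PowerSeries.coeff_X_pow_mul', Polynomial.coeff_coe, hT, Polynomial.finsetSum_coeff]
    simp only [Polynomial.coeff_C_mul_X_pow, Finset.sum_ite_eq, Finset.mem_range]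
    by_cases hn : n < N
    · simp [hn]
    · simp [hn, not_lt.1 hn, h n (not_lt.1 hn)]
  have hq : (((1 - Polynomial.X) * T + Polynomial.C e * Polynomial.X ^ N : ℤ[X]) : ℤ⟦X⟧) =
      (1 - PowerSeries.X) * hilbertSeries I := by
    have hone := PowerSeries.mk_one_mul_one_sub_eq_one ℤ
    rw [hs]
    push_cast
    linear_combination (-(PowerSeries.C e * PowerSeries.X ^ N)) * hone
  have hex : ∃ p : ℤ[X], (p : ℤ⟦X⟧) = (1 - PowerSeries.X) * hilbertSeries I := ⟨_, hq⟩
  rw [hPolynomial, dif_pos hex]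
  exact Polynomial.coe_injective ℤ (hex.choose_spec.trans hq.symm)

theorem idealMult_eq {I : Ideal R} {N : ℕ} {e : ℤ}
    (h : ∀ n ≥ N, (hilbertFunction I n : ℤ) = e) : idealMult I = e := by
  rw [idealMult, hPolynomial_eq h]
  simp

theorem genus_eq {I : Ideal R} {N : ℕ} {e : ℤ} (h : ∀ n ≥ N, (hilbertFunction I n : ℤ) = e) :
    genus I = e * N - ∑ n ∈ Finset.range N, (hilbertFunction I n : ℤ) := by
  rw [genus, hPolynomial_eq h]
  simp only [Polynomial.derivative_add, Polynomial.derivative_mul, Polynomial.derivative_sub,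
    Polynomial.derivative_one, Polynomial.derivative_X, Polynomial.derivative_C,
    Polynomial.derivative_X_pow, Polynomial.eval_add, Polynomial.eval_mul, Polynomial.eval_sub,
    Polynomial.eval_one, Polynomial.eval_X, Polynomial.eval_C, Polynomial.eval_pow,
    Polynomial.eval_zero, Polynomial.eval_finsetSum, one_pow]
  simp
  ring

end Hilbert

/-! ### Powers of an ideal in the quotient field -/

section Powers

variable {R : Type*} [CommRing R] {K : Type*} [Field K] [Algebra R K]

theorem powK_add (I : Ideal R) (m n : ℕ) : powK K I (m + n) = powK K I m * powK K I n := by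
  rw [← IsLocalization.coeSubmodule_mul, ← pow_add]

theorem coeSubmodule_span_singleton_mul (x : R) (J : Ideal R) :
    IsLocalization.coeSubmodule K (Ideal.span {x} * J) =
      scale (algebraMap R K x) (IsLocalization.coeSubmodule K J) := by
  ext y
  rw [IsLocalization.coeSubmodule_mul, IsLocalization.coeSubmodule_span_singleton,
    Submodule.mem_span_singleton_mul, mem_scale]

theorem powK_le_base (I : Ideal R) (n : ℕ) : powK K I n ≤ base R K := by
  rintro _ ⟨r, -, rfl⟩
  exact Submodule.mem_one.2 ⟨r, rfl⟩

theorem powK_zero (I : Ideal R) : powK K I 0 = base R K := by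
  rw [powK, pow_zero, Ideal.one_eq_top, IsLocalization.coeSubmodule_top]

theorem powK_anti (I : Ideal R) (n : ℕ) : powK K I (n + 1) ≤ powK K I n :=
  Submodule.map_mono (Ideal.pow_le_pow_right n.le_succ)

theorem pow_mem_powK {I : Ideal R} {x : R} (hx : x ∈ I) (n : ℕ) :
    algebraMap R K x ^ n ∈ powK K I n :=
  ⟨x ^ n, Ideal.pow_mem_pow hx n, map_pow (algebraMap R K) x n⟩

theorem one_mem_Lam (I : Ideal R) : (1 : K) ∈ Lam K I :=
  (mem_Lam K I 1).2 ⟨0, Submodule.mem_div_iff_forall_mul_mem.2 fun y hy => by rwa [one_mul]⟩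

theorem base_le_Lam (I : Ideal R) : base R K ≤ Lam K I := Submodule.one_le.2 (one_mem_Lam I)

theorem mul_mem_Lam {I : Ideal R} {y z : K} (hy : y ∈ Lam K I) (hz : z ∈ Lam K I) :
    y * z ∈ Lam K I := by
  obtain ⟨m, hm⟩ := (mem_Lam K I y).1 hy
  obtain ⟨n, hn⟩ := (mem_Lam K I z).1 hz
  have hm' := powK_div_powK_mono K I (le_max_left m n) hm
  have hn' := powK_div_powK_mono K I (le_max_right m n) hn
  refine (mem_Lam K I _).2 ⟨max m n, Submodule.mem_div_iff_forall_mul_mem.2 fun b hb => ?_⟩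
  rw [mul_assoc]
  exact Submodule.mem_div_iff_forall_mul_mem.1 hm' _
    (Submodule.mem_div_iff_forall_mul_mem.1 hn' b hb)

theorem hilbertFunction_eq_len [IsFractionRing R K] (I : Ideal R) (n : ℕ) :
    hilbertFunction I n = len (powK K I n) (powK K I (n + 1)) := by
  rw [hilbertFunction, len, powK, powK, IsLocalization.coeSubmodule, IsLocalization.coeSubmodule,
    length_subquotient_map]
  exact IsFractionRing.injective R K

variable [IsDomain R] [IsFractionRing R K]

theorem Lam_le_intCl [IsNoetherianRing R] {I : Ideal R} (hI : I ≠ ⊥) : Lam K I ≤ intCl R K := by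
  intro y hy
  obtain ⟨n, hn⟩ := (mem_Lam K I y).1 hy
  rw [Submodule.mem_div_iff_forall_mul_mem] at hn
  refine isIntegral_of_smul_mem_submodule (powK K I n) ?_ ?_ y hn
  · obtain ⟨a, ha, ha0⟩ := Submodule.exists_mem_ne_zero_of_ne_bot (pow_ne_zero n hI)
    exact (Submodule.ne_bot_iff _).2 ⟨algebraMap R K a, ⟨a, ha, rfl⟩, by simpa using ha0⟩
  · exact (IsNoetherian.noetherian (I ^ n)).map _

variable [IsDiscreteValuationRing (integralClosure R K)]

theorem isBig_powK [Module.Finite R (integralClosure R K)] {I : Ideal R} (hI : I ≠ ⊥) (n : ℕ) :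
    IsBig (powK K I n) := by
  obtain ⟨a, ha, ha0⟩ := Submodule.exists_mem_ne_zero_of_ne_bot (pow_ne_zero n hI)
  obtain ⟨g, hg, hg0⟩ := exists_mem_conductor_ne_zero R K
  refine ⟨(powK_le_base I n).trans base_le_intCl, exists_cut_le_of_mul_mem
    (g := algebraMap R K a * g) (mul_ne_zero ?_ hg0) fun s hs => ?_⟩
  · simpa using ha0
  · obtain ⟨r, hr⟩ := Submodule.mem_one.1 (mem_dual.1 hg s hs)
    refine ⟨a * r, Ideal.mul_mem_right _ _ ha, ?_⟩
    rw [Algebra.linearMap_apply, map_mul, hr, mul_assoc]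

/-! ### Minimal reductions -/

theorem exists_mem_forall_val_le {I : Ideal R} (hI : I ≠ ⊥) :
    ∃ x ∈ I, x ≠ 0 ∧ ∀ y ∈ I, val R K (algebraMap R K y) ≤ val R K (algebraMap R K x) := by
  classical
  have hval : ∀ x : R, x ≠ 0 → ∃ n : ℕ, val R K (algebraMap R K x) = WithZero.exp (-(n : ℤ)) := by
    intro x hx
    obtain ⟨m, hm⟩ := exists_val_eq_exp (R := R) (x := algebraMap R K x) (by simpa using hx)
    lift m to ℕ using nonneg_of_mem_valueSet base_le_intCl ⟨_, Submodule.mem_one.2 ⟨x, rfl⟩, hm⟩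
    exact ⟨m, hm⟩
  have hex : ∃ n : ℕ, ∃ x ∈ I, val R K (algebraMap R K x) = WithZero.exp (-(n : ℤ)) := by
    obtain ⟨a, ha, ha0⟩ := Submodule.exists_mem_ne_zero_of_ne_bot hI
    exact (hval a ha0).imp fun n hn => ⟨a, ha, hn⟩
  obtain ⟨x, hx, hxv⟩ := Nat.find_spec hex
  refine ⟨x, hx, by simpa using ne_zero_of_val_eq_exp hxv, fun y hy => ?_⟩
  rcases eq_or_ne y 0 with rfl | hy0
  · simp
  · obtain ⟨m, hm⟩ := hval y hy0
    have := Nat.find_min' hex ⟨y, hy, hm⟩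
    rw [hm, hxv, WithZero.exp_le_exp]
    omega

variable (K) in
theorem exists_isMinimalReduction [IsNoetherianRing R] [Module.Finite R (integralClosure R K)]
    {I : Ideal R} (hI : I ≠ ⊥) : ∃ x, IsMinimalReduction I x := by
  obtain ⟨x, hx, hx0, hmin⟩ := exists_mem_forall_val_le (K := K) hI
  refine ⟨x, hx, ?_⟩
  set X := algebraMap R K x with hX
  have hX0 : X ≠ 0 := by simpa [hX] using hx0
  have hdiv : ∀ n, ∀ y ∈ powK K I n, y / X ^ n ∈ intCl R K := by
    intro n
    induction n with
    | zero =>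
      intro y hy
      simpa using base_le_intCl (powK_le_base I 0 hy)
    | succ n ih =>
      intro y hy
      rw [powK_add] at hy
      induction hy using Submodule.mul_induction_on' with
      | mem_mul_mem a ha b hb =>
        rw [pow_succ, mul_div_mul_comm]
        refine (integralClosure R K).mul_mem (ih a ha) ?_
        obtain ⟨c, hc, rfl⟩ := hb
        rw [SetLike.mem_coe, pow_one] at hc
        change _ ∈ intCl R K
        rw [← val_le_one_iff, map_div₀]
        exact div_le_one_of_le₀ (hmin c hc) zero_le
      | add a _ b _ h1 h2 =>
        rw [add_div]
        exact add_mem h1 h2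
  let A : ℕ → Submodule R K := fun n => scale (X ^ n)⁻¹ (powK K I n)
  have hAS : ∀ n, A n ≤ intCl R K := by
    rintro n _ ⟨a, ha, rfl⟩
    rw [LinearMap.mulLeft_apply, mul_comm, ← div_eq_mul_inv]
    exact hdiv n a ha
  have hA : Monotone A := by
    refine monotone_nat_of_le_succ ?_
    rintro n _ ⟨a, ha, rfl⟩
    refine ⟨a * X, ?_, ?_⟩
    · have h1 := pow_mem_powK (K := K) hx 1
      rw [pow_one] at h1
      exact (powK_add I n 1).ge (Submodule.mul_mem_mul ha h1)
    · simp only [LinearMap.mulLeft_apply]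
      field_simp
      ring
  have hnoeth : IsNoetherian R (intCl R K) :=
    inferInstanceAs (IsNoetherian R (integralClosure R K))
  obtain ⟨N, hN⟩ := monotone_stabilizes_iff_noetherian.2 hnoeth
    ⟨fun n => (A n).submoduleOf (intCl R K), fun m n h => Submodule.comap_mono (hA h)⟩
  have hAN : ∀ n ≥ N, A (n + 1) ≤ A n := by
    intro n hn y hy
    have h1 : (A n).submoduleOf (intCl R K) = (A (n + 1)).submoduleOf (intCl R K) :=
      (hN n hn).symm.trans (hN (n + 1) (by omega))
    have h2 : (⟨y, hAS _ hy⟩ : intCl R K) ∈ (A n).submoduleOf (intCl R K) := h1 ▸ hy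
    exact h2
  refine ⟨N, fun n hn => le_antisymm ?_ ?_⟩
  · rw [← IsFractionRing.coeSubmodule_le_coeSubmodule (K := K), coeSubmodule_span_singleton_mul]
    intro y hy
    obtain ⟨a, ha, hay⟩ := hAN n hn ⟨y, hy, rfl⟩
    refine ⟨a, ha, ?_⟩
    simp only [LinearMap.mulLeft_apply] at hay ⊢
    rw [← hX]
    field_simp at hay
    refine mul_left_cancel₀ (pow_ne_zero n hX0) ?_
    rw [← hay]
    ring
  · rw [pow_succ']
    exact Ideal.mul_mono_left ((Ideal.span_singleton_le_iff_mem _).2 hx)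

end Powers

theorem IsMinimalReduction.ne_zero {R : Type*} [CommRing R] [IsDomain R] {I : Ideal R} {x : R}
    (hI : I ≠ ⊥) (h : IsMinimalReduction I x) : x ≠ 0 := by
  rintro rfl
  obtain ⟨-, N, hN⟩ := h
  have := hN N le_rfl
  rw [Ideal.span_singleton_eq_bot.2 rfl, Ideal.bot_mul] at this
  exact pow_ne_zero _ hI this

theorem IsMinimalReduction.pow_succ_eq {R : Type*} [CommRing R] {I : Ideal R} {x : R}
    (h : IsMinimalReduction I x) {n : ℕ} (hn : reductionExponent I x ≤ n) :
    I ^ (n + 1) = Ideal.span {x} * I ^ n :=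
  Nat.sInf_mem (s := {m : ℕ | ∀ n ≥ m, I ^ (n + 1) = Ideal.span {x} * I ^ n}) h.2 n hn

section BlowingUp

variable {R : Type*} [CommRing R] {K : Type*} [Field K] [Algebra R K]

theorem IsMinimalReduction.powK_succ {I : Ideal R} {x : R} (h : IsMinimalReduction I x) {n : ℕ}
    (hn : reductionExponent I x ≤ n) :
    powK K I (n + 1) = scale (algebraMap R K x) (powK K I n) := by
  rw [powK, h.pow_succ_eq hn, coeSubmodule_span_singleton_mul]

theorem IsMinimalReduction.powK_add_reductionExponent {I : Ideal R} {x : R}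
    (h : IsMinimalReduction I x) (n : ℕ) :
    powK K I (reductionExponent I x + n) =
      scale (algebraMap R K x ^ n) (powK K I (reductionExponent I x)) := by
  induction n with
  | zero => ext y; simp [mem_scale]
  | succ n ih => rw [← add_assoc, h.powK_succ (by omega), ih, pow_succ', scale_mul]

variable [IsDomain R] [IsFractionRing R K]

theorem IsMinimalReduction.powK_eq_scale_Lam {I : Ideal R} {x : R} (hI : I ≠ ⊥)
    (h : IsMinimalReduction I x) :
    powK K I (reductionExponent I x) =
      scale (algebraMap R K x ^ reductionExponent I x) (Lam K I) := by
  set X := algebraMap R K x with hX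
  have hX0 : X ≠ 0 := by simpa [hX] using h.ne_zero hI
  set ν := reductionExponent I x with hν
  refine le_antisymm (fun a ha => ?_) ?_
  · refine ⟨(X ^ ν)⁻¹ * a, (mem_Lam K I _).2 ⟨ν, ?_⟩, ?_⟩
    · refine Submodule.mem_div_iff_forall_mul_mem.2 fun b hb => ?_
      have hab : a * b ∈ powK K I (ν + ν) := (powK_add I ν ν).ge (Submodule.mul_mem_mul ha hb)
      rw [h.powK_add_reductionExponent] at hab
      obtain ⟨c, hc, hcab⟩ := hab
      rw [LinearMap.mulLeft_apply] at hcab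
      rw [mul_assoc, ← hcab, inv_mul_cancel_left₀ (pow_ne_zero _ hX0)]
      exact hc
    · exact mul_inv_cancel_left₀ (pow_ne_zero _ hX0) a
  · rintro _ ⟨y, hy, rfl⟩
    obtain ⟨n, hn⟩ := (mem_Lam K I y).1 hy
    have hn' := powK_div_powK_mono K I (Nat.le_add_left n ν) hn
    have h1 := Submodule.mem_div_iff_forall_mul_mem.1 hn' _ (pow_mem_powK h.1 (ν + n))
    rw [h.powK_add_reductionExponent] at h1
    obtain ⟨c, hc, hcy⟩ := h1
    rw [LinearMap.mulLeft_apply, ← hX, pow_add] at hcy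
    have h2 : X ^ ν * y = c :=
      mul_left_cancel₀ (pow_ne_zero n hX0) (by rw [hcy]; ring)
    rw [LinearMap.mulLeft_apply, h2]
    exact hc

theorem IsMinimalReduction.powK_le_dual_Lam {I : Ideal R} {x : R} (hI : I ≠ ⊥)
    (h : IsMinimalReduction I x) : powK K I (reductionExponent I x) ≤ dual (Lam K I) := by
  intro b hb
  refine mem_dual.2 fun y hy => powK_le_base I (reductionExponent I x) ?_
  rw [h.powK_eq_scale_Lam hI] at hb ⊢
  obtain ⟨c, hc, rfl⟩ := hb
  exact ⟨c * y, mul_mem_Lam hc hy, (mul_assoc _ _ _).symm⟩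

theorem IsMinimalReduction.dual_dual_Lam {I : Ideal R} {x : R} (hI : I ≠ ⊥)
    (h : IsMinimalReduction I x) (hd : dual (Lam K I) = powK K I (reductionExponent I x)) :
    dual (dual (Lam K I)) = Lam K I := by
  have hX0 : algebraMap R K x ^ reductionExponent I x ≠ 0 :=
    pow_ne_zero _ (by simpa using h.ne_zero hI)
  have h1 := h.powK_eq_scale_Lam (K := K) hI
  rw [hd, h1, dual_scale hX0, hd, h1, ← scale_mul, inv_mul_cancel₀ hX0]
  ext y
  simp [mem_scale]

variable [IsDiscreteValuationRing (integralClosure R K)] [Module.Finite R (integralClosure R K)]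

theorem IsMinimalReduction.hilbertFunction_eq (hres : ResiduallyRational R K) {I : Ideal R} {x : R}
    (hI : I ≠ ⊥) (h : IsMinimalReduction I x) {n : ℕ} (hn : reductionExponent I x ≤ n) :
    (hilbertFunction I n : ℤ) = colen R K (scale (algebraMap R K x) (intCl R K)) := by
  have hx : algebraMap R K x ∈ intCl R K := (integralClosure R K).algebraMap_mem x
  rw [hilbertFunction_eq_len (K := K), len_eq_colen_sub hres (isBig_powK hI _) (powK_anti I n)
    (isBig_powK hI n).1, h.powK_succ hn,
    colen_scale hres hx (by simpa using h.ne_zero hI) (isBig_powK hI n)]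
  ring

theorem IsMinimalReduction.colen_powK [IsNoetherianRing R] (hres : ResiduallyRational R K)
    {I : Ideal R} {x : R} (hI : I ≠ ⊥) (h : IsMinimalReduction I x) :
    colen R K (powK K I (reductionExponent I x)) =
      colen R K (Lam K I) + idealMult I * reductionExponent I x := by
  have hx : algebraMap R K x ∈ intCl R K := (integralClosure R K).algebraMap_mem x
  rw [h.powK_eq_scale_Lam hI, colen_scale_pow hres hx (by simpa using h.ne_zero hI)
    (isBig_base.mono (base_le_Lam I) (Lam_le_intCl hI)),
    idealMult_eq fun n hn => h.hilbertFunction_eq hres hI hn]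
  ring

theorem IsMinimalReduction.genus_eq [IsNoetherianRing R] (hres : ResiduallyRational R K)
    {I : Ideal R} {x : R} (hI : I ≠ ⊥) (h : IsMinimalReduction I x) :
    genus I = colen R K (base R K) - colen R K (Lam K I) := by
  have hH : ∀ n ≥ reductionExponent I x, (hilbertFunction I n : ℤ) =
      colen R K (scale (algebraMap R K x) (intCl R K)) := fun n hn => h.hilbertFunction_eq hres hI hn
  have hsum : ∑ n ∈ Finset.range (reductionExponent I x), (hilbertFunction I n : ℤ) =
      colen R K (powK K I (reductionExponent I x)) - colen R K (powK K I 0) := by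
    rw [← Finset.sum_range_sub fun n => colen R K (powK K I n)]
    refine Finset.sum_congr rfl fun n _ => ?_
    rw [hilbertFunction_eq_len (K := K), len_eq_colen_sub hres (isBig_powK hI _) (powK_anti I n)
      (isBig_powK hI n).1]
  rw [BlowUp.genus_eq hH, hsum, h.colen_powK hres hI, idealMult_eq hH, powK_zero]
  ring

theorem IsMinimalReduction.two_mul_genus [IsNoetherianRing R] (hres : ResiduallyRational R K)
    {I : Ideal R} {x : R} (hI : I ≠ ⊥) (h : IsMinimalReduction I x) :
    2 * genus I = idealMult I * (reductionExponent I x : ℤ)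
      + ∑ i ∈ Finset.Icc 1 (typeLength R K) \ Gam (dual (Lam K I)), ((typeSeq R K i : ℤ) - 1)
      - dInv (dual (Lam K I))
      - (len (dual (dual (Lam K I))) (Lam K I) : ℤ)
      - (len (dual (Lam K I)) (powK K I (reductionExponent I x)) : ℤ) := by
  have hLS : Lam K I ≤ intCl R K := Lam_le_intCl hI
  have hL : IsBig (Lam K I) := isBig_base.mono (base_le_Lam I) hLS
  have hJ : conductor R K ≤ dual (Lam K I) := dual_anti hLS
  have hJR : dual (Lam K I) ≤ base R K := dual_le_base (one_mem_Lam I)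
  have hd : dInv (dual (Lam K I)) = colen R K (dual (dual (Lam K I))) -
    ∑ i ∈ Gam (dual (Lam K I)), (typeSeq R K i : ℤ) := rfl
  have hsub : Gam (dual (Lam K I)) ⊆ Finset.Icc 1 (typeLength R K) := by
    classical
    exact Finset.filter_subset _ _
  have h1 := Finset.sum_sdiff (f := fun i => (typeSeq R K i : ℤ)) hsub
  rw [sum_typeSeq hres] at h1
  have h2 := colen_eq_card_Gam hres hJ hJR
  have h3 := h.genus_eq hres hI
  have h4 := h.colen_powK hres hI
  rw [len_eq_colen_sub hres hL (le_dual_dual _) (dual_le_intCl hJ),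
    len_eq_colen_sub hres (isBig_powK hI _) (h.powK_le_dual_Lam hI) (hJR.trans base_le_intCl),
    hd, Finset.sum_sub_distrib, Finset.sum_const, nsmul_one]
  linarith

end BlowingUp

end BlowUp

end

open BlowUp in
theorem theorem4p6 {R : Type*} [CommRing R] [IsDomain R] [IsLocalRing R] [IsNoetherianRing R]
    (hdim : ringKrullDim R = 1) [Infinite (IsLocalRing.ResidueField R)]
    (K : Type*) [Field K] [Algebra R K] [IsFractionRing R K]
    [Module.Finite R (integralClosure R K)] [IsDiscreteValuationRing (integralClosure R K)]
    (hres : ResiduallyRational R K)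
    (I : Ideal R) (hI : I.IsPrimary ∧ I.radical = IsLocalRing.maximalIdeal R)
    (hIp : ¬ Submodule.IsPrincipal I) :
    (∃ x, IsMinimalReduction I x) ∧
    ∀ x, IsMinimalReduction I x →
      -- (1): `Λ = Lam K I`, `R : Λ = dual (Lam K I)`, `Λ** = dual (dual (Lam K I))`
      2 * genus I = idealMult I * (reductionExponent I x : ℤ)
          + ∑ i ∈ Finset.Icc 1 (typeLength R K) \ Gam (dual (Lam K I)), ((typeSeq R K i : ℤ) - 1)
          - dInv (dual (Lam K I))
          - (len (dual (dual (Lam K I))) (Lam K I) : ℤ)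
          - (len (dual (Lam K I)) (powK K I (reductionExponent I x)) : ℤ) ∧
      -- (2)
      (2 * genus I = idealMult I * (reductionExponent I x : ℤ)
          + ∑ i ∈ Finset.Icc 1 (typeLength R K) \ Gam (dual (Lam K I)), ((typeSeq R K i : ℤ) - 1) ↔
        dual (Lam K I) = powK K I (reductionExponent I x) ∧ dInv (dual (Lam K I)) = 0) := by
  have hI0 : I ≠ ⊥ := by
    rintro rfl
    exact hIp inferInstance
  refine ⟨exists_isMinimalReduction K hI0, fun x hx => ?_⟩
  have h := hx.two_mul_genus hres hI0
  refine ⟨h, ?_⟩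
  have hLS : Lam K I ≤ intCl R K := Lam_le_intCl hI0
  have hJR : dual (Lam K I) ≤ base R K := dual_le_base (one_mem_Lam I)
  constructor
  · intro h2
    have hd := dInv_nonneg hres (dual_anti hLS) hJR
    have h3 := Int.natCast_nonneg (len (dual (dual (Lam K I))) (Lam K I))
    have h4 := Int.natCast_nonneg (len (dual (Lam K I)) (powK K I (reductionExponent I x)))
    have h5 := len_eq_colen_sub hres (isBig_powK hI0 _) (hx.powK_le_dual_Lam hI0)
      (hJR.trans base_le_intCl)
    exact ⟨eq_of_colen_eq hres (isBig_powK hI0 _) (hx.powK_le_dual_Lam hI0)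
      (hJR.trans base_le_intCl) (by linarith), by linarith⟩
  · rintro ⟨hJ, hd⟩
    rw [hx.dual_dual_Lam hI0 hJ, hd, hJ] at h
    have hlen : ∀ A : Submodule R K, len A A = 0 := fun A => by
      rw [len, length_subquotient_eq_zero le_rfl]
      rfl
    rw [hlen, hlen] at h
    rw [hJ, h]
    simp
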